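/- Let $\mathcal H$ be a finite-dimensional complex Hilbert space with trace $\operatorname{tr}$ on $\mathcal B(\mathcal H)$, let $\mathcal M\subseteq\mathcal B(\mathcal H)$ be a matrix algebra (a subalgebra containing the identity and closed under adjoints), and let $\mathcal N\subseteq\mathcal M$ be a unital matrix subalgebra. Let $\mathcal E:\mathcal M\to\mathcal N$ be the trace-preserving conditional expectation onto $\mathcal N$, i.e. the linear map that is positive, satisfies $\mathcal E(B)=B$ and $\mathcal E(AB)=\mathcal E(A)B$ for all $A\in\mathcal M$, $B\in\mathcal N$, and satisfies $\operatorname{tr}\mathcal E(A)=\operatorname{tr}A$ for all $A\in\mathcal M$. Let $\sigma,\rho\in\mathcal M$ be positive definite, and put $\sigma_{\mathcal N}=\mathcal E(\sigma)$, $\rho_{\mathcal N}=\mathcal E(\rho)$, $\Gamma=\sigma^{-1/2}\rho\,\sigma^{-1/2}$ and $\Gamma_{\mathcal N}=\sigma_{\mathcal N}^{-1/2}\rho_{\mathcal N}\,\sigma_{\mathcal N}^{-1/2}$. For positive definite $\alpha,\beta\in\mathcal B(\mathcal H)$ let $$\hat S_{\mathrm{BS}}(\alpha\|\beta)=-\operatorname{tr}\bigl[\alpha\log(\alpha^{-1/2}\beta\,\alpha^{-1/2})\bigr]$$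 be the Belavkin–Staszewski entropy. Then the following are equivalent: 1. $\hat S_{\mathrm{BS}}(\sigma\|\rho)=\hat S_{\mathrm{BS}}(\sigma_{\mathcal N}\|\rho_{\mathcal N})$. 2. $\rho=\sigma\,\sigma_{\mathcal N}^{-1}\rho_{\mathcal N}$. 3. $\sigma^{1/2}\sigma_{\mathcal N}^{-1/2}\,\Gamma_{\mathcal N}^{1/2}\,\sigma_{\mathcal N}^{1/2}=\Gamma^{1/2}\sigma^{1/2}$. -/

import Mathlib

/-- The algebra `𝓑(H)` of bounded linear operators on `H`. -/
abbrev Op (H : Type*) [NormedAddCommGroup H] [InnerProductSpace ℂ H] : Type _ := H →L[ℂ] H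

/-- The (unnormalized) trace of an operator on a finite-dimensional Hilbert space. -/
noncomputable def opTrace {H : Type*} [NormedAddCommGroup H] [InnerProductSpace ℂ H]
    (A : Op H) : ℂ :=
  LinearMap.trace ℂ H (A : H →ₗ[ℂ] H)

/-- `E : M → N` is a trace-preserving conditional expectation of the matrix algebra `M` onto its
unital matrix subalgebra `N`. Matrix algebras are unital `*`-subalgebras of `𝓑(H)`; positivity and
trace are those of `𝓑(H)`. -/
structure IsTracePreservingCondExp {H : Type*} [NormedAddCommGroup H] [InnerProductSpace ℂ H]
    [CompleteSpace H] {M N : StarSubalgebra ℂ (Op H)} (hNM : N ≤ M) (E : M →ₗ[ℂ] N) : Prop where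
  map_nonneg : ∀ A : M, 0 ≤ (A : Op H) → 0 ≤ (E A : Op H)
  map_of_mem : ∀ B : N, E (StarSubalgebra.inclusion hNM B) = B
  map_mul : ∀ (A : M) (B : N), E (A * StarSubalgebra.inclusion hNM B) = E A * B
  trace_map : ∀ A : M, opTrace (E A : Op H) = opTrace (A : Op H)

/-- `Γ = σ^{-1/2} ρ σ^{-1/2}`; real powers are those of the continuous functional calculus. -/
noncomputable def opGamma {H : Type*} [NormedAddCommGroup H] [InnerProductSpace ℂ H]
    [CompleteSpace H] (σ ρ : Op H) : Op H :=
  σ ^ (-(1 / 2) : ℝ) * ρ * σ ^ (-(1 / 2) : ℝ)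

/-- The Belavkin-Staszewski entropy `-tr[σ log(σ^{-1/2} ρ σ^{-1/2})]` of positive definite
`σ`, `ρ`. The trace is real (see `coe_bsEntropy`). -/
noncomputable def bsEntropy {H : Type*} [NormedAddCommGroup H] [InnerProductSpace ℂ H]
    [CompleteSpace H] (σ ρ : Op H) : ℝ :=
  -(opTrace (σ * CFC.log (opGamma σ ρ))).re

/-- Taking the real part in `bsEntropy` loses nothing. -/
theorem coe_bsEntropy {H : Type*} [NormedAddCommGroup H] [InnerProductSpace ℂ H]
    [CompleteSpace H] [FiniteDimensional ℂ H] (σ ρ : Op H) (hσ : 0 ≤ σ) :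
    (bsEntropy σ ρ : ℂ) = -opTrace (σ * CFC.log (opGamma σ ρ)) := by
  have hL : IsSelfAdjoint (CFC.log (opGamma σ ρ)) := IsSelfAdjoint.log
  have hσ' : IsSelfAdjoint σ := IsSelfAdjoint.of_nonneg hσ
  have key : ∀ A : Op H, opTrace (star A) = star (opTrace A) := by
    intro A
    let b := stdOrthonormalBasis ℂ H
    unfold opTrace
    rw [LinearMap.trace_eq_sum_inner _ b, LinearMap.trace_eq_sum_inner _ b, star_sum]
    refine Finset.sum_congr rfl fun i _ => ?_
    simp only [ContinuousLinearMap.coe_coe, ContinuousLinearMap.star_eq_adjoint,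
      ContinuousLinearMap.adjoint_inner_right]
    exact (inner_conj_symm _ _).symm
  have comm : ∀ A B : Op H, opTrace (A * B) = opTrace (B * A) := fun A B =>
    LinearMap.trace_mul_comm ℂ (A : H →ₗ[ℂ] H) (B : H →ₗ[ℂ] H)
  have h : star (opTrace (σ * CFC.log (opGamma σ ρ))) = opTrace (σ * CFC.log (opGamma σ ρ)) := by
    rw [← key, star_mul, hL.star_eq, hσ'.star_eq, comm]
  have := Complex.conj_eq_iff_re.mp h
  rw [bsEntropy, Complex.ofReal_neg, this]

/-! The functional `f ↦ Re tr (σ f(Γ))` is integration against a finitely supported measure `μ` on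
`(0, ∞)`, so the entropy of `σ, ρ` is `-∫ log dμ`; that of `σ_N, ρ_N` is `-∫ log dμ'`, where `μ'`
has the same mass because `E` preserves the trace. Equal masses give `∫ log dμ - ∫ log dμ' = -∫₀^∞
(D s - D' s) ds` for the Stieltjes transforms `D`, `D'`.

Here `D s = tr (σ (ρ + s σ)⁻¹ σ)`, and completing a square gives `tr (A_N B_N⁻¹ A_N) ≤ tr (A B⁻¹
A)`, with equality iff `A = B B_N⁻¹ A_N` (`opTrace_mul_inverse_mul`). Hence `D' ≤ D`, and equal
entropies mean `D = D'`. For `A = σ`, `B = ρ + s σ` the equality case is condition 2, whatever `s`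
is.

Condition 2 also says that `σ^{1/2} σ_N^{-1/2}` intertwines `Γ` and `Γ_N`. Passing to square roots
gives condition 3, and squaring goes back. -/

set_option linter.unusedSectionVars false

/-! ### Functional calculus and trace in finite dimension -/

section Functional

open Polynomial

variable {H : Type*} [NormedAddCommGroup H] [InnerProductSpace ℂ H] [CompleteSpace H]
  [FiniteDimensional ℂ H]

/-- By spectral mapping, every spectral value is a root of the real minimal polynomial. Finiteness
makes every function continuous on the spectrum and equal to a polynomial there. -/
theorem finite_real_spectrum (A : Op H) : (spectrum ℝ A).Finite := by
  have hint : IsIntegral ℝ A := IsIntegral.of_finite ℝ A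
  have hne : minpoly ℝ A ≠ 0 := minpoly.ne_zero hint
  refine ((minpoly ℝ A).roots.toFinset.finite_toSet).subset fun x hx => ?_
  have hmem : (minpoly ℝ A).eval x ∈ spectrum ℝ (aeval A (minpoly ℝ A)) :=
    spectrum.subset_polynomial_aeval A _ ⟨x, hx, rfl⟩
  have h0 : (minpoly ℝ A).eval x = 0 := by
    by_contra hc
    rw [minpoly.aeval, spectrum.mem_iff, sub_zero] at hmem
    exact hmem ((IsUnit.mk0 _ hc).map (algebraMap ℝ (Op H)))
  simp [hne, h0]

theorem continuousOn_real_spectrum (f : ℝ → ℝ) (A : Op H) : ContinuousOn f (spectrum ℝ A) :=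
  (finite_real_spectrum A).continuousOn f

/-- On a finite set every function is a polynomial. -/
theorem exists_polynomial_eqOn {s : Set ℝ} (hs : s.Finite) (f : ℝ → ℝ) :
    ∃ p : ℝ[X], Set.EqOn f p.eval s := by
  classical
  refine ⟨Lagrange.interpolate hs.toFinset id f, fun x hx => ?_⟩
  exact (Lagrange.eval_interpolate_at_node (v := id) f Function.injective_id.injOn
    (hs.mem_toFinset.2 hx)).symm

/-- The functional calculus respects intertwiners of self-adjoint operators. -/
theorem cfc_mul_eq_mul_cfc {A B S : Op H} (hA : IsSelfAdjoint A) (hB : IsSelfAdjoint B)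
    (h : A * S = S * B) (f : ℝ → ℝ) : cfc f A * S = S * cfc f B := by
  -- A single polynomial must serve both operators, hence the union of the spectra.
  obtain ⟨p, hp⟩ :=
    exists_polynomial_eqOn ((finite_real_spectrum A).union (finite_real_spectrum B)) f
  rw [cfc_congr (hp.mono Set.subset_union_left), cfc_congr (hp.mono Set.subset_union_right),
    cfc_polynomial p A, cfc_polynomial p B]
  clear hp
  induction p using Polynomial.induction_on' with
  | add p q hp hq => rw [map_add, map_add, add_mul, mul_add, hp, hq]
  | monomial n a =>
    have hpow : A ^ n * S = S * B ^ n :=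
      (SemiconjBy.pow_right (show SemiconjBy S B A from h.symm) n).symm
    rw [aeval_monomial, aeval_monomial, ← Algebra.smul_def, ← Algebra.smul_def, smul_mul_assoc,
      hpow, mul_smul_comm]

theorem cfc_apply_eigenvector {A : Op H} (hA : IsSelfAdjoint A) {l : ℝ} {x : H}
    (hx : A x = (l : ℂ) • x) (hl : l ∈ spectrum ℝ A) (f : ℝ → ℝ) :
    cfc f A x = (f l : ℂ) • x := by
  obtain ⟨p, hp⟩ := exists_polynomial_eqOn (finite_real_spectrum A) f
  rw [cfc_congr hp, cfc_polynomial p A, hp hl]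
  clear hp
  beta_reduce
  have hpow : ∀ n : ℕ, (A ^ n) x = ((l : ℂ) ^ n) • x := by
    intro n
    induction n with
    | zero => simp
    | succ n ih =>
      rw [pow_succ', mul_apply_eq_comp, ih, map_smul, hx, smul_smul, pow_succ]
  induction p using Polynomial.induction_on' with
  | add p q hp' hq' =>
    rw [map_add, add_apply, hp', hq', eval_add, Complex.ofReal_add, add_smul]
  | monomial n a =>
    rw [aeval_monomial, ← Algebra.smul_def, smul_apply, hpow, eval_monomial]
    push_cast
    rw [mul_smul, Complex.coe_smul]

theorem opTrace_mul_comm (A B : Op H) : opTrace (A * B) = opTrace (B * A) :=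
  LinearMap.trace_mul_comm ℂ (A : H →ₗ[ℂ] H) (B : H →ₗ[ℂ] H)

theorem opTrace_sub (A B : Op H) : opTrace (A - B) = opTrace A - opTrace B := by
  simp [opTrace]

theorem opTrace_eq_sum_inner {ι : Type*} [Fintype ι] (b : OrthonormalBasis ι ℂ H) (A : Op H) :
    opTrace A = ∑ i, inner ℂ (b i) (A (b i)) := by
  unfold opTrace
  rw [LinearMap.trace_eq_sum_inner _ b]
  rfl

/-- The trace is the squared Hilbert–Schmidt norm of `Z`. -/
theorem opTrace_star_mul_self_re (Z : Op H) : 0 ≤ (opTrace (star Z * Z)).re ∧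
    ((opTrace (star Z * Z)).re = 0 → Z = 0) := by
  have key : (opTrace (star Z * Z)).re = ∑ i, ‖Z (stdOrthonormalBasis ℂ H i)‖ ^ 2 := by
    rw [opTrace_eq_sum_inner (stdOrthonormalBasis ℂ H), Complex.re_sum]
    refine Finset.sum_congr rfl fun i _ => ?_
    rw [mul_apply_eq_comp, ContinuousLinearMap.star_eq_adjoint,
      ContinuousLinearMap.adjoint_inner_right, inner_self_eq_norm_sq_to_K]
    norm_cast
  rw [key]
  refine ⟨by positivity, fun h => ?_⟩
  have h0 := (Finset.sum_eq_zero_iff_of_nonneg (fun i _ => by positivity)).1 h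
  have hZ : (Z : H →ₗ[ℂ] H) = 0 := by
    refine (stdOrthonormalBasis ℂ H).toBasis.ext fun i => ?_
    have := h0 i (Finset.mem_univ i)
    simpa using this
  ext x
  exact LinearMap.congr_fun hZ x

/-- Functionals `f ↦ Re tr (A f(G))` are integrals against a finitely supported measure carried by
the spectrum of `G`. -/
theorem exists_weights {A G : Op H} (hG : IsSelfAdjoint G) :
    ∃ (n : ℕ) (l w : Fin n → ℝ), (∀ i, l i ∈ spectrum ℝ G) ∧
      ∀ f : ℝ → ℝ, (opTrace (A * cfc f G)).re = ∑ i, w i * f (l i) := by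
  have hsym : (G : H →ₗ[ℂ] H).IsSymmetric := ContinuousLinearMap.isSelfAdjoint_iff_isSymmetric.1 hG
  let b := hsym.eigenvectorBasis rfl
  have hb : ∀ i, G (b i) = ((hsym.eigenvalues rfl i : ℝ) : ℂ) • b i := fun i =>
    hsym.apply_eigenvectorBasis rfl i
  have hspec : ∀ i, hsym.eigenvalues rfl i ∈ spectrum ℝ G := by
    intro i
    rw [spectrum.mem_iff]
    intro hu
    obtain ⟨u, hu⟩ := hu
    have h1 : (u : Op H) (b i) = 0 := by
      rw [hu, sub_apply, hb, Algebra.algebraMap_eq_smul_one]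
      simp
    have h2 : ((↑u⁻¹ : Op H) * (u : Op H)) (b i) = 0 := by
      rw [mul_apply_eq_comp, h1, map_zero]
    rw [Units.inv_mul] at h2
    exact b.orthonormal.ne_zero i h2
  -- The weights are the diagonal entries of `A` in an eigenbasis of `G`.
  refine ⟨_, hsym.eigenvalues rfl, fun i => (inner ℂ (b i) (A (b i)) : ℂ).re, hspec, fun f => ?_⟩
  rw [opTrace_eq_sum_inner b, Complex.re_sum]
  refine Finset.sum_congr rfl fun i _ => ?_
  rw [mul_apply_eq_comp, cfc_apply_eigenvector hG (hb i) (hspec i), map_smul,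
    inner_smul_right, Complex.re_ofReal_mul, mul_comm]

end Functional

/-! ### Comparing logarithmic integrals through Stieltjes transforms -/

section Scalar

open Filter Topology

theorem tendsto_sum_mul_log_add {n : ℕ} (l w : Fin n → ℝ) :
    Tendsto (fun s => ∑ i, w i * Real.log (l i + s) - (∑ i, w i) * Real.log s) atTop (𝓝 0) := by
  have h : Tendsto (fun s : ℝ => ∑ i, w i * (Real.log (s + l i) - Real.log s)) atTop
      (𝓝 (∑ i, w i * 0)) :=
    tendsto_finsetSum _ fun i _ => (Real.tendsto_log_comp_add_sub_log (l i)).const_mul _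
  simp only [mul_zero, Finset.sum_const_zero] at h
  refine h.congr fun s => ?_
  rw [Finset.sum_mul, ← Finset.sum_sub_distrib]
  exact Finset.sum_congr rfl fun i _ => by rw [add_comm, mul_sub]

theorem hasDerivAt_sum_mul_log_add {n : ℕ} {l w : Fin n → ℝ} (hl : ∀ i, 0 < l i) {s : ℝ}
    (hs : 0 ≤ s) :
    HasDerivAt (fun s => ∑ i, w i * Real.log (l i + s)) (∑ i, w i * (l i + s)⁻¹) s := by
  refine HasDerivAt.fun_sum fun i _ => ?_
  have h := (((hasDerivAt_id s).const_add (l i)).log (by have := hl i; simp; positivity)).const_mul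
    (w i)
  simpa using h

/-- If the Stieltjes transforms of two finitely supported measures on `(0, ∞)` of equal mass are
ordered, then the integrals of `log` agree if and only if the transforms do; the latter may be
tested in a single point. -/
theorem sum_mul_log_eq_iff {n m : ℕ} {l w : Fin n → ℝ} {l' w' : Fin m → ℝ} (hl : ∀ i, 0 < l i)
    (hl' : ∀ i, 0 < l' i) (hw : ∑ i, w i = ∑ i, w' i)
    (hD : ∀ s, 0 ≤ s → ∑ i, w' i * (l' i + s)⁻¹ ≤ ∑ i, w i * (l i + s)⁻¹) {P : Prop}
    (hP : ∀ s, 0 ≤ s → (∑ i, w i * (l i + s)⁻¹ = ∑ i, w' i * (l' i + s)⁻¹ ↔ P)) :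
    ∑ i, w i * Real.log (l i) = ∑ i, w' i * Real.log (l' i) ↔ P := by
  set φ : ℝ → ℝ := fun s => ∑ i, w i * Real.log (l i + s) - ∑ i, w' i * Real.log (l' i + s)
    with hφ
  have hder : ∀ s, 0 ≤ s →
      HasDerivAt φ (∑ i, w i * (l i + s)⁻¹ - ∑ i, w' i * (l' i + s)⁻¹) s := fun s hs =>
    (hasDerivAt_sum_mul_log_add hl hs).sub (hasDerivAt_sum_mul_log_add hl' hs)
  have hlim : Tendsto φ atTop (𝓝 0) := by
    have h := (tendsto_sum_mul_log_add l w).sub (tendsto_sum_mul_log_add l' w')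
    rw [sub_zero] at h
    refine h.congr fun s => ?_
    rw [hw]
    simp only [hφ]
    ring
  have hφ0 : φ 0 = ∑ i, w i * Real.log (l i) - ∑ i, w' i * Real.log (l' i) := by simp [hφ]
  have hmono : MonotoneOn φ (Set.Ici 0) := by
    refine monotoneOn_of_deriv_nonneg (convex_Ici 0)
      (fun s hs => (hder s hs).continuousAt.continuousWithinAt)
      (fun s hs => (hder s (interior_subset hs)).differentiableAt.differentiableWithinAt)
      fun s hs => ?_
    rw [(hder s (interior_subset hs)).deriv]
    exact sub_nonneg.2 (hD s (interior_subset hs))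
  rw [← sub_eq_zero, ← hφ0]
  constructor
  · intro h0
    -- `φ` increases to its limit `0`; if it also starts at `0`, it vanishes identically.
    have hle : ∀ s, 0 ≤ s → φ s ≤ 0 := fun s hs =>
      ge_of_tendsto hlim ((eventually_ge_atTop s).mono fun t ht =>
        hmono hs (hs.trans ht) ht)
    have hzero : ∀ s, 0 ≤ s → φ s = 0 := fun s hs =>
      le_antisymm (hle s hs) (h0 ▸ hmono (Set.mem_Ici.2 le_rfl) hs hs)
    -- Any point interior to `[0, ∞)` would do: there `φ' = 0` means that the transforms agree.
    have hev : φ =ᶠ[𝓝 1] fun _ => 0 :=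
      (eventually_gt_nhds (zero_lt_one)).mono fun s hs => hzero s hs.le
    have h1 := (hder 1 zero_le_one).unique (hev.hasDerivAt_iff.2 (hasDerivAt_const _ _))
    exact (hP 1 zero_le_one).1 (sub_eq_zero.1 h1)
  · intro hp
    have hanti : AntitoneOn φ (Set.Ici 0) := by
      refine antitoneOn_of_deriv_nonpos (convex_Ici 0)
        (fun s hs => (hder s hs).continuousAt.continuousWithinAt)
        (fun s hs => (hder s (interior_subset hs)).differentiableAt.differentiableWithinAt)
        fun s hs => ?_
      rw [(hder s (interior_subset hs)).deriv, (hP s (interior_subset hs)).2 hp, sub_self]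
    refine tendsto_nhds_unique (tendsto_const_nhds.congr' ?_) hlim
    exact (eventually_ge_atTop 0).mono fun s hs =>
      le_antisymm (hmono (Set.mem_Ici.2 le_rfl) hs hs) (hanti (Set.mem_Ici.2 le_rfl) hs hs)

end Scalar

/-! ### Conditional expectations and the trace inequality -/

section CondExp

variable {H : Type*} [NormedAddCommGroup H] [InnerProductSpace ℂ H] [CompleteSpace H]
  [FiniteDimensional ℂ H]

theorem isClosed_starSubalgebra (N : StarSubalgebra ℂ (Op H)) : IsClosed (N : Set (Op H)) :=
  Submodule.closed_of_finiteDimensional N.toSubalgebra.toSubmodule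

/-- Spectral permanence: closed star subalgebras contain the inverses of their invertible elements.
-/
theorem ringInverse_mem (N : StarSubalgebra ℂ (Op H)) {B : Op H} (hB : B ∈ N) :
    Ring.inverse B ∈ N := by
  by_cases hu : IsUnit B
  · have := isClosed_starSubalgebra N
    obtain ⟨u, hu'⟩ := (StarSubalgebra.coe_isUnit N (a := ⟨B, hB⟩)).1 hu
    have h1 : B * ((↑u⁻¹ : N) : Op H) = 1 := by
      have := congrArg (Subtype.val : N → Op H) u.mul_inv
      rwa [hu'] at this
    have h2 : Ring.inverse B = ((↑u⁻¹ : N) : Op H) := by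
      rw [← one_mul ((↑u⁻¹ : N) : Op H), ← Ring.inverse_mul_cancel B hu, mul_assoc, h1, mul_one]
    rw [h2]
    exact Subtype.property _
  · rw [Ring.inverse_non_unit _ hu]
    exact N.zero_mem

variable {M N : StarSubalgebra ℂ (Op H)} {hNM : N ≤ M} {E : M →ₗ[ℂ] N}

namespace IsTracePreservingCondExp

theorem opTrace_map_mul (hE : IsTracePreservingCondExp hNM E) (A : M) {B : Op H} (hB : B ∈ N) :
    opTrace ((A : Op H) * B) = opTrace ((E A : Op H) * B) := by
  have h := hE.trace_map (A * StarSubalgebra.inclusion hNM ⟨B, hB⟩)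
  rw [hE.map_mul] at h
  exact h.symm

/-- A strictly positive `A` dominates some `r • 1` with `r > 0`, and the positive unital `E` keeps
this bound. -/
theorem isStrictlyPositive_map (hE : IsTracePreservingCondExp hNM E) {A : M}
    (hA : IsStrictlyPositive (A : Op H)) : IsStrictlyPositive (E A : Op H) := by
  rcases subsingleton_or_nontrivial (Op H) with _ | _
  · exact IsStrictlyPositive.of_subsingleton
  obtain ⟨r, hr, hle⟩ := (CFC.exists_pos_algebraMap_le_iff (A := Op H) hA.isSelfAdjoint).2
    ((StarOrderedRing.isStrictlyPositive_iff_spectrum_pos (A : Op H)).1 hA)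
  have h1 : E 1 = 1 := by
    have := hE.map_of_mem 1
    rwa [map_one] at this
  have h := hE.map_nonneg (A - (r : ℂ) • 1) (by
    rw [Algebra.algebraMap_eq_smul_one] at hle
    simpa using hle)
  rw [map_sub, map_smul, h1] at h
  refine IsStrictlyPositive.of_le (isStrictlyPositive_algebraMap (A := Op H) hr) ?_
  rw [Algebra.algebraMap_eq_smul_one]
  simpa using h

/-- The trace inequality `tr (A_N B_N⁻¹ A_N) ≤ tr (A B⁻¹ A)` and its equality case. -/
theorem opTrace_mul_inverse_mul (hE : IsTracePreservingCondExp hNM E) {A B : M}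
    (hA : IsStrictlyPositive (A : Op H)) (hB : IsStrictlyPositive (B : Op H)) :
    (opTrace ((E A : Op H) * Ring.inverse (E B : Op H) * (E A : Op H))).re ≤
        (opTrace ((A : Op H) * Ring.inverse (B : Op H) * (A : Op H))).re ∧
      ((opTrace ((A : Op H) * Ring.inverse (B : Op H) * (A : Op H))).re =
          (opTrace ((E A : Op H) * Ring.inverse (E B : Op H) * (E A : Op H))).re ↔
        (A : Op H) = (B : Op H) * Ring.inverse (E B : Op H) * (E A : Op H)) := by
  have hEA := hE.isStrictlyPositive_map hA
  have hEB := hE.isStrictlyPositive_map hB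
  have hKN : Ring.inverse (E B : Op H) * (E A : Op H) ∈ N :=
    N.mul_mem (ringInverse_mem N (E B).2) (E A).2
  have hBK : (E B : Op H) * (Ring.inverse (E B : Op H) * (E A : Op H)) = E A := by
    rw [← mul_assoc, Ring.mul_inverse_cancel _ hEB.isUnit, one_mul]
  have hAK : opTrace ((A : Op H) * (Ring.inverse (E B : Op H) * (E A : Op H))) =
      opTrace ((E A : Op H) * Ring.inverse (E B : Op H) * (E A : Op H)) := by
    rw [hE.opTrace_map_mul A hKN, mul_assoc]
  have hAsa : star (A : Op H) = A := hA.isSelfAdjoint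
  have hBsa : star (B : Op H) = B := hB.isSelfAdjoint
  obtain ⟨r, hr, hrsa, hrr⟩ :=
    CStarAlgebra.isStrictlyPositive_iff_exists_isUnit_and_isSelfAdjoint_and_eq_mul_self.1
      hB.ringInverse
  have hKstar : star (Ring.inverse (E B : Op H) * (E A : Op H)) =
      (E A : Op H) * Ring.inverse (E B : Op H) := by
    rw [star_mul, hEA.isSelfAdjoint.star_eq, hEB.ringInverse.isSelfAdjoint.star_eq]
  rw [mul_assoc (B : Op H)]
  generalize hK : Ring.inverse (E B : Op H) * (E A : Op H) = K at *
  have hKsN : star K ∈ N := N.star_mem' hKN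
  have hKA : opTrace (star K * (A : Op H)) = opTrace ((E A : Op H) * star K) := by
    rw [opTrace_mul_comm, hE.opTrace_map_mul A hKsN]
  -- Since `K * star K ∈ N`, the trace allows replacing `B` by `E B`, and `E B * K = E A`.
  have hKBK : opTrace (star K * (B : Op H) * K) = opTrace ((E A : Op H) * star K) := by
    rw [mul_assoc, opTrace_mul_comm, mul_assoc, hE.opTrace_map_mul B (N.mul_mem hKN hKsN),
      ← mul_assoc, hBK]
  have hBi : (B : Op H) * Ring.inverse (B : Op H) = 1 := Ring.mul_inverse_cancel _ hB.isUnit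
  have hiB : Ring.inverse (B : Op H) * (B : Op H) = 1 := Ring.inverse_mul_cancel _ hB.isUnit
  -- The completed square, with `r * r = B⁻¹`. Under the trace the last bracket cancels and `A * K`
  -- yields the `N`-side term.
  have hexp : star (r * ((A : Op H) - (B : Op H) * K)) * (r * ((A : Op H) - (B : Op H) * K)) =
      (A : Op H) * Ring.inverse (B : Op H) * (A : Op H) - (A : Op H) * K -
        (star K * (A : Op H) - star K * (B : Op H) * K) := by
    rw [star_mul, hrsa.star_eq, star_sub, star_mul, hAsa, hBsa]
    calc ((A : Op H) - star K * (B : Op H)) * r * (r * ((A : Op H) - (B : Op H) * K))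
        = ((A : Op H) - star K * (B : Op H)) * (r * r) * ((A : Op H) - (B : Op H) * K) := by
          noncomm_ring
      _ = ((A : Op H) - star K * (B : Op H)) * Ring.inverse (B : Op H) *
          ((A : Op H) - (B : Op H) * K) := by rw [hrr]
      _ = (A : Op H) * Ring.inverse (B : Op H) * (A : Op H) - A * (Ring.inverse (B : Op H) * B) * K -
          (star K * (B * Ring.inverse (B : Op H)) * A -
            star K * (B * Ring.inverse (B : Op H)) * B * K) := by noncomm_ring
      _ = _ := by rw [hBi, hiB, mul_one, mul_one]
  obtain ⟨hpos, hzero⟩ := opTrace_star_mul_self_re (r * ((A : Op H) - (B : Op H) * K))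
  rw [hexp, opTrace_sub, opTrace_sub, opTrace_sub, hKA, hKBK, sub_self, sub_zero, hAK,
    Complex.sub_re] at hpos hzero
  refine ⟨by linarith, fun h => ?_, fun h => ?_⟩
  · have h0 := hzero (by linarith)
    exact sub_eq_zero.1 ((hr.mul_right_eq_zero).1 h0)
  · have := congrArg (fun Z => (opTrace (star (r * Z) * (r * Z))).re) (sub_eq_zero.2 h)
    simp only [hexp, opTrace_sub, hKA, hKBK, hAK] at this
    have h0 : opTrace (0 : Op H) = 0 := by simp [opTrace]
    simp only [sub_self, sub_zero, mul_zero, h0, Complex.sub_re, Complex.zero_re] at this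
    linarith

end IsTracePreservingCondExp

end CondExp

/-! ### The operator `Γ`: resolvents and square roots -/

section Gamma

variable {H : Type*} [NormedAddCommGroup H] [InnerProductSpace ℂ H] [CompleteSpace H]
  [FiniteDimensional ℂ H]

theorem ofReal_smul_nonneg {A : Op H} {s : ℝ} (hs : 0 ≤ s) (hA : 0 ≤ A) :
    0 ≤ (s : ℂ) • A := by
  rw [Complex.coe_smul]
  exact smul_nonneg hs hA

theorem isStrictlyPositive_opGamma {σ ρ : Op H} (hσ : IsStrictlyPositive σ)
    (hρ : IsStrictlyPositive ρ) : IsStrictlyPositive (opGamma σ ρ) := by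
  have h : IsStrictlyPositive (σ ^ (-(1 / 2) : ℝ)) := IsStrictlyPositive.rpow σ _ hσ
  exact IsStrictlyPositive.conjugate_of_isUnit_of_isSelfAdjoint ρ _ h.isUnit h.isSelfAdjoint hρ

theorem rpow_half_mul_rpow_half {σ : Op H} (hσ : IsStrictlyPositive σ) :
    σ ^ (1 / 2 : ℝ) * σ ^ (1 / 2 : ℝ) = σ := by
  rw [← CFC.rpow_add hσ.isUnit, add_halves, CFC.rpow_one σ hσ.nonneg]

theorem rpow_neg_half_mul_rpow_neg_half {σ : Op H} (hσ : IsStrictlyPositive σ) :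
    σ ^ (-(1 / 2) : ℝ) * σ ^ (-(1 / 2) : ℝ) = Ring.inverse σ := by
  rw [← CFC.rpow_add hσ.isUnit, CFC.inverse_eq_rpow_neg_one hσ]
  norm_num

theorem rpow_half_mul_opGamma_mul_rpow_half {σ : Op H} (ρ : Op H) (hσ : IsStrictlyPositive σ) :
    σ ^ (1 / 2 : ℝ) * opGamma σ ρ * σ ^ (1 / 2 : ℝ) = ρ := by
  unfold opGamma
  calc σ ^ (1 / 2 : ℝ) * (σ ^ (-(1 / 2) : ℝ) * ρ * σ ^ (-(1 / 2) : ℝ)) * σ ^ (1 / 2 : ℝ)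
      = (σ ^ (1 / 2 : ℝ) * σ ^ (-(1 / 2) : ℝ)) * ρ * (σ ^ (-(1 / 2) : ℝ) * σ ^ (1 / 2 : ℝ)) := by
        noncomm_ring
    _ = ρ := by rw [CFC.rpow_mul_rpow_neg _ hσ, CFC.rpow_neg_mul_rpow _ hσ, one_mul, mul_one]

/-- `tr (σ (Γ + s)⁻¹) = tr (σ (ρ + s σ)⁻¹ σ)`. -/
theorem opTrace_mul_cfc_inv_opGamma {σ ρ : Op H} (hσ : IsStrictlyPositive σ)
    (hρ : IsStrictlyPositive ρ) {s : ℝ} (hs : 0 ≤ s) :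
    opTrace (σ * cfc (fun x : ℝ => (x + s)⁻¹) (opGamma σ ρ)) =
      opTrace (σ * Ring.inverse (ρ + (s : ℂ) • σ) * σ) := by
  have hΓ := isStrictlyPositive_opGamma hσ hρ
  have hpos : ∀ x ∈ spectrum ℝ (opGamma σ ρ), 0 < x := fun x hx => hΓ.spectrum_pos hx
  have hsa : IsSelfAdjoint (opGamma σ ρ) := hΓ.isSelfAdjoint
  have hρ' := rpow_half_mul_opGamma_mul_rpow_half ρ hσ
  have hσ' := rpow_half_mul_rpow_half hσ
  have hpn := CFC.rpow_mul_rpow_neg (1 / 2) hσ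
  have hnp := CFC.rpow_neg_mul_rpow (1 / 2) hσ
  generalize opGamma σ ρ = G at *
  set C := cfc (fun x : ℝ => (x + s)⁻¹) G with hC
  have hCG : C * (G + (s : ℂ) • 1) = 1 := by
    have h1 : cfc (fun x : ℝ => x + s) G = G + (s : ℂ) • 1 := by
      rw [cfc_add_const s (fun x : ℝ => x) G, cfc_id' ℝ G, Algebra.algebraMap_eq_smul_one]
      simp
    rw [← h1, hC, ← cfc_mul _ _ G (continuousOn_real_spectrum _ _)
      (continuousOn_real_spectrum _ _), ← cfc_one ℝ G]
    refine cfc_congr fun x hx => ?_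
    have := hpos x hx
    exact inv_mul_cancel₀ (by positivity)
  -- This inverts `ρ + s σ = σ^{1/2} (Γ + s) σ^{1/2}`.
  have hinv : Ring.inverse (ρ + (s : ℂ) • σ) = σ ^ (-(1 / 2) : ℝ) * C * σ ^ (-(1 / 2) : ℝ) := by
    have hB : ρ + (s : ℂ) • σ = σ ^ (1 / 2 : ℝ) * (G + (s : ℂ) • 1) * σ ^ (1 / 2 : ℝ) := by
      rw [mul_add, add_mul, hρ', mul_smul_comm, mul_one, smul_mul_assoc, hσ']
    have hu : IsUnit (ρ + (s : ℂ) • σ) :=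
      (hρ.add_nonneg (ofReal_smul_nonneg hs hσ.nonneg)).isUnit
    have hl : σ ^ (-(1 / 2) : ℝ) * C * σ ^ (-(1 / 2) : ℝ) * (ρ + (s : ℂ) • σ) = 1 := by
      rw [hB]
      calc _ = σ ^ (-(1 / 2) : ℝ) * (C * ((σ ^ (-(1 / 2) : ℝ) * σ ^ (1 / 2 : ℝ)) *
            (G + (s : ℂ) • 1))) * σ ^ (1 / 2 : ℝ) := by simp only [mul_assoc]
        _ = 1 := by rw [hnp, one_mul, hCG, mul_one, hnp]
    rw [← one_mul (Ring.inverse _), ← hl, mul_assoc, Ring.mul_inverse_cancel _ hu, mul_one]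
  rw [hinv]
  calc opTrace (σ * C) = opTrace (σ ^ (1 / 2 : ℝ) * (σ ^ (1 / 2 : ℝ) * C)) := by
        rw [← mul_assoc, hσ']
    _ = opTrace (σ ^ (1 / 2 : ℝ) * C * σ ^ (1 / 2 : ℝ)) := opTrace_mul_comm _ _
    _ = opTrace (σ ^ (1 / 2 : ℝ) * (σ ^ (1 / 2 : ℝ) * σ ^ (-(1 / 2) : ℝ)) * C *
          (σ ^ (-(1 / 2) : ℝ) * σ ^ (1 / 2 : ℝ)) * σ ^ (1 / 2 : ℝ)) := by
        rw [hpn, hnp, mul_one, mul_one]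
    _ = opTrace ((σ ^ (1 / 2 : ℝ) * σ ^ (1 / 2 : ℝ)) * (σ ^ (-(1 / 2) : ℝ) * C *
          σ ^ (-(1 / 2) : ℝ)) * (σ ^ (1 / 2 : ℝ) * σ ^ (1 / 2 : ℝ))) := by simp only [mul_assoc]
    _ = _ := by rw [hσ']

/-- The algebraic equality condition in terms of an intertwiner of the square roots. -/
theorem eq_mul_inverse_mul_iff_rpow_half_opGamma {σ ρ σ' ρ' : Op H} (hσ : IsStrictlyPositive σ)
    (hρ : IsStrictlyPositive ρ) (hσ' : IsStrictlyPositive σ') (hρ' : IsStrictlyPositive ρ') :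
    ρ = σ * Ring.inverse σ' * ρ' ↔
      σ ^ (1 / 2 : ℝ) * σ' ^ (-(1 / 2) : ℝ) * opGamma σ' ρ' ^ (1 / 2 : ℝ) * σ' ^ (1 / 2 : ℝ) =
        opGamma σ ρ ^ (1 / 2 : ℝ) * σ ^ (1 / 2 : ℝ) := by
  have hΓ := isStrictlyPositive_opGamma hσ hρ
  have hΓ' := isStrictlyPositive_opGamma hσ' hρ'
  have hq := rpow_half_mul_rpow_half hσ
  have hqn := rpow_neg_half_mul_rpow_neg_half hσ'
  have hnp := CFC.rpow_neg_mul_rpow (1 / 2) hσ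
  have hpn' := CFC.rpow_mul_rpow_neg (1 / 2) hσ'
  have hnp' := CFC.rpow_neg_mul_rpow (1 / 2) hσ'
  have hg := rpow_half_mul_opGamma_mul_rpow_half ρ hσ
  have hg2 := rpow_half_mul_rpow_half hΓ
  have hg2' := rpow_half_mul_rpow_half hΓ'
  have hdef : opGamma σ ρ = σ ^ (-(1 / 2) : ℝ) * ρ * σ ^ (-(1 / 2) : ℝ) := rfl
  have hdef' : opGamma σ' ρ' = σ' ^ (-(1 / 2) : ℝ) * ρ' * σ' ^ (-(1 / 2) : ℝ) := rfl
  constructor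
  · intro h
    have hint : opGamma σ ρ * (σ ^ (1 / 2 : ℝ) * σ' ^ (-(1 / 2) : ℝ)) =
        σ ^ (1 / 2 : ℝ) * σ' ^ (-(1 / 2) : ℝ) * opGamma σ' ρ' := by
      calc _ = σ ^ (-(1 / 2) : ℝ) * ρ * (σ ^ (-(1 / 2) : ℝ) * σ ^ (1 / 2 : ℝ)) *
            σ' ^ (-(1 / 2) : ℝ) := by rw [hdef]; simp only [mul_assoc]
        _ = σ ^ (-(1 / 2) : ℝ) * (σ * Ring.inverse σ' * ρ') * σ' ^ (-(1 / 2) : ℝ) := by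
            rw [hnp, mul_one, ← h]
        _ = σ ^ (-(1 / 2) : ℝ) * (σ ^ (1 / 2 : ℝ) * σ ^ (1 / 2 : ℝ) *
            (σ' ^ (-(1 / 2) : ℝ) * σ' ^ (-(1 / 2) : ℝ)) * ρ') * σ' ^ (-(1 / 2) : ℝ) := by
            rw [hq, hqn]
        _ = (σ ^ (-(1 / 2) : ℝ) * σ ^ (1 / 2 : ℝ)) * σ ^ (1 / 2 : ℝ) * σ' ^ (-(1 / 2) : ℝ) *
            (σ' ^ (-(1 / 2) : ℝ) * ρ' * σ' ^ (-(1 / 2) : ℝ)) := by simp only [mul_assoc]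
        _ = _ := by rw [hnp, one_mul, hdef']
    have hroot := cfc_mul_eq_mul_cfc hΓ.isSelfAdjoint hΓ'.isSelfAdjoint hint
      (fun x : ℝ => x ^ (1 / 2 : ℝ))
    rw [← CFC.rpow_eq_cfc_real hΓ.nonneg, ← CFC.rpow_eq_cfc_real hΓ'.nonneg] at hroot
    rw [← hroot, mul_assoc, mul_assoc (σ ^ (1 / 2 : ℝ)), hnp', mul_one]
  · intro h
    generalize opGamma σ ρ ^ (1 / 2 : ℝ) = R at *
    generalize opGamma σ' ρ' ^ (1 / 2 : ℝ) = R' at *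
    -- `T` is a square root of `σ'⁻¹ ρ'`, and the hypothesis reads `σ^{1/2} T = R σ^{1/2}`; applying
    -- it twice turns `ρ = σ^{1/2} R² σ^{1/2}` into `σ T²`.
    set T := σ' ^ (-(1 / 2) : ℝ) * R' * σ' ^ (1 / 2 : ℝ) with hT
    have hqT : σ ^ (1 / 2 : ℝ) * T = R * σ ^ (1 / 2 : ℝ) := by
      rw [← h, hT]; simp only [mul_assoc]
    have hTT : T * T = Ring.inverse σ' * ρ' := by
      calc T * T = σ' ^ (-(1 / 2) : ℝ) * R' * (σ' ^ (1 / 2 : ℝ) * σ' ^ (-(1 / 2) : ℝ)) * R' *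
            σ' ^ (1 / 2 : ℝ) := by rw [hT]; simp only [mul_assoc]
        _ = σ' ^ (-(1 / 2) : ℝ) * (R' * R') * σ' ^ (1 / 2 : ℝ) := by
            rw [hpn', mul_one]; simp only [mul_assoc]
        _ = (σ' ^ (-(1 / 2) : ℝ) * σ' ^ (-(1 / 2) : ℝ)) * ρ' *
            (σ' ^ (-(1 / 2) : ℝ) * σ' ^ (1 / 2 : ℝ)) := by
            rw [hg2', hdef']; simp only [mul_assoc]
        _ = _ := by rw [hqn, hnp', mul_one]
    calc ρ = σ ^ (1 / 2 : ℝ) * (R * (R * σ ^ (1 / 2 : ℝ))) := by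
          rw [← hg, ← hg2]; simp only [mul_assoc]
      _ = σ ^ (1 / 2 : ℝ) * (R * σ ^ (1 / 2 : ℝ)) * T := by
          rw [← hqT, ← mul_assoc R, ← hqT]; simp only [mul_assoc]
      _ = (σ ^ (1 / 2 : ℝ) * σ ^ (1 / 2 : ℝ)) * (T * T) := by
          rw [← hqT]; simp only [mul_assoc]
      _ = _ := by rw [hq, hTT, mul_assoc]

end Gamma

/-! ### Equality of the entropies -/

section BSEntropy

variable {H : Type*} [NormedAddCommGroup H] [InnerProductSpace ℂ H] [CompleteSpace H]
  [FiniteDimensional ℂ H]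

/-- One measure is tested on `log`, on `1` and on `x ↦ (x + s)⁻¹`. -/
theorem exists_weights_opGamma {σ ρ : Op H} (hσ : IsStrictlyPositive σ)
    (hρ : IsStrictlyPositive ρ) :
    ∃ (n : ℕ) (l w : Fin n → ℝ), (∀ i, 0 < l i) ∧
      bsEntropy σ ρ = -∑ i, w i * Real.log (l i) ∧
      (opTrace σ).re = ∑ i, w i ∧
      ∀ s : ℝ, 0 ≤ s → (opTrace (σ * Ring.inverse (ρ + (s : ℂ) • σ) * σ)).re =
        ∑ i, w i * (l i + s)⁻¹ := by
  have hΓ := isStrictlyPositive_opGamma hσ hρ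
  obtain ⟨n, l, w, hl, hw⟩ := exists_weights (A := σ) hΓ.isSelfAdjoint
  refine ⟨n, l, w, fun i => hΓ.spectrum_pos (hl i), ?_, ?_, fun s hs => ?_⟩
  · rw [← hw]
    rfl
  · have h1 := hw fun _ => 1
    have hsa := hΓ.isSelfAdjoint
    rw [cfc_const_one ℝ (opGamma σ ρ), mul_one] at h1
    simpa using h1
  · rw [← opTrace_mul_cfc_inv_opGamma hσ hρ hs, hw]

theorem IsTracePreservingCondExp.bsEntropy_eq_iff {M N : StarSubalgebra ℂ (Op H)} {hNM : N ≤ M}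
    {E : M →ₗ[ℂ] N} (hE : IsTracePreservingCondExp hNM E) {σ ρ : M}
    (hσ : IsStrictlyPositive (σ : Op H)) (hρ : IsStrictlyPositive (ρ : Op H)) :
    bsEntropy (σ : Op H) (ρ : Op H) = bsEntropy (E σ : Op H) (E ρ : Op H) ↔
      (ρ : Op H) = (σ : Op H) * Ring.inverse (E σ : Op H) * (E ρ : Op H) := by
  have hσ' := hE.isStrictlyPositive_map hσ
  have hρ' := hE.isStrictlyPositive_map hρ
  obtain ⟨n, l, w, hl, hS, hw, hD⟩ := exists_weights_opGamma hσ hρ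
  obtain ⟨m, l', w', hl', hS', hw', hD'⟩ := exists_weights_opGamma hσ' hρ'
  have hpos : ∀ s : ℝ, 0 ≤ s → IsStrictlyPositive ((ρ + (s : ℂ) • σ : M) : Op H) := fun s hs => by
    have : (0 : Op H) ≤ (s : ℂ) • (σ : Op H) := ofReal_smul_nonneg hs hσ.nonneg
    simpa using hρ.add_nonneg this
  have key := fun (s : ℝ) (hs : 0 ≤ s) => hE.opTrace_mul_inverse_mul hσ (hpos s hs)
  have hcoe : ∀ s : ℝ, ((ρ + (s : ℂ) • σ : M) : Op H) = (ρ : Op H) + (s : ℂ) • (σ : Op H) :=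
    fun s => rfl
  have hcoe' : ∀ s : ℝ, (E (ρ + (s : ℂ) • σ) : Op H) = (E ρ : Op H) + (s : ℂ) • (E σ : Op H) :=
    fun s => by rw [map_add, map_smul]; rfl
  -- The equality case does not depend on `s`: once the inverses are moved across, `s σ` appears on
  -- both sides and cancels.
  have hcond : ∀ s : ℝ, 0 ≤ s → ((σ : Op H) = ((ρ : Op H) + (s : ℂ) • (σ : Op H)) *
      Ring.inverse ((E ρ : Op H) + (s : ℂ) • (E σ : Op H)) * (E σ : Op H) ↔
      (ρ : Op H) = (σ : Op H) * Ring.inverse (E σ : Op H) * (E ρ : Op H)) := by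
    intro s hs
    have hu := (hE.isStrictlyPositive_map (hpos s hs)).isUnit
    rw [hcoe'] at hu
    have hE1 := Ring.mul_inverse_cancel _ hσ'.isUnit
    have hE2 := Ring.inverse_mul_cancel _ hσ'.isUnit
    have hB1 := Ring.mul_inverse_cancel _ hu
    have hB2 := Ring.inverse_mul_cancel _ hu
    have hlin : (σ : Op H) * Ring.inverse (E σ : Op H) *
        ((E ρ : Op H) + (s : ℂ) • (E σ : Op H)) =
        (σ : Op H) * Ring.inverse (E σ : Op H) * (E ρ : Op H) + (s : ℂ) • (σ : Op H) := by
      rw [mul_add, mul_smul_comm, mul_assoc (σ : Op H) _ (E σ : Op H), hE2, mul_one]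
    have hstep : (σ : Op H) = ((ρ : Op H) + (s : ℂ) • (σ : Op H)) *
        Ring.inverse ((E ρ : Op H) + (s : ℂ) • (E σ : Op H)) * (E σ : Op H) ↔
        (ρ : Op H) + (s : ℂ) • (σ : Op H) = (σ : Op H) * Ring.inverse (E σ : Op H) *
          ((E ρ : Op H) + (s : ℂ) • (E σ : Op H)) := by
      generalize (E ρ : Op H) + (s : ℂ) • (E σ : Op H) = B' at *
      generalize (ρ : Op H) + (s : ℂ) • (σ : Op H) = B
      constructor
      · intro h
        have h' : (σ : Op H) * Ring.inverse (E σ : Op H) = B * Ring.inverse B' := by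
          rw [congrArg (fun Z => Z * Ring.inverse (E σ : Op H)) h, mul_assoc, hE1, mul_one]
        rw [h', mul_assoc, hB2, mul_one]
      · intro h
        rw [h, mul_assoc _ B', hB1, mul_one, mul_assoc, hE2, mul_one]
    rw [hstep, hlin, add_left_inj]
  rw [hS, hS', neg_inj]
  refine sum_mul_log_eq_iff hl hl' ?_ (fun s hs => ?_) (fun s hs => ?_)
  · rw [← hw, ← hw', hE.trace_map]
  · have h := (key s hs).1
    rwa [hcoe, hcoe', hD s hs, hD' s hs] at h
  · have h := (key s hs).2
    rw [hcoe, hcoe', hD s hs, hD' s hs] at h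
    exact h.trans (hcond s hs)

end BSEntropy

theorem corollary4p6 {H : Type*} [NormedAddCommGroup H] [InnerProductSpace ℂ H]
    [CompleteSpace H] [FiniteDimensional ℂ H]
    (M N : StarSubalgebra ℂ (Op H)) (hNM : N ≤ M)
    (E : M →ₗ[ℂ] N) (hE : IsTracePreservingCondExp hNM E)
    (σ ρ : M) (hσ : IsStrictlyPositive (σ : Op H)) (hρ : IsStrictlyPositive (ρ : Op H)) :
    List.TFAE [
      bsEntropy (σ : Op H) (ρ : Op H) = bsEntropy (E σ : Op H) (E ρ : Op H),
      (ρ : Op H) = (σ : Op H) * Ring.inverse (E σ : Op H) * (E ρ : Op H),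
      (σ : Op H) ^ (1 / 2 : ℝ) * (E σ : Op H) ^ (-(1 / 2) : ℝ) *
          opGamma (E σ : Op H) (E ρ : Op H) ^ (1 / 2 : ℝ) * (E σ : Op H) ^ (1 / 2 : ℝ) =
        opGamma (σ : Op H) (ρ : Op H) ^ (1 / 2 : ℝ) * (σ : Op H) ^ (1 / 2 : ℝ)] := by
  tfae_have 1 ↔ 2 := hE.bsEntropy_eq_iff hσ hρ
  tfae_have 2 ↔ 3 := eq_mul_inverse_mul_iff_rpow_half_opGamma hσ hρ
    (hE.isStrictlyPositive_map hσ) (hE.isStrictlyPositive_map hρ)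
  tfae_finish
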